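/- Let $q>1$ and $\kappa>0$, and let $u\in C^4(\mathbb R^3)$ be a positive, radially symmetric solution of $\Delta^2u+u^{-q}=0$ in $\mathbb R^3$ with exactly quadratic growth $\kappa$ at infinity, i.e. $\lim_{|x|\to+\infty}u(x)/|x|^2=\kappa$. Write $u(r)$ for the common value of $u$ on the sphere $|x|=r$. Then the following hold. (a) If $q>3/2$, then $\int_0^{\infty}t^2u(t)^{-q}\,dt$ is finite and $$\lim_{|x|\to+\infty}\frac{u(x)-\kappa|x|^2}{|x|}=\frac12\int_0^{\infty}t^2u(t)^{-q}\,dt.$$ (b) If $q=3/2$, then $$\lim_{|x|\to+\infty}\frac{u(x)-\kappa|x|^2}{|x|\log|x|}=\frac1{2\kappa^{3/2}}.$$ (c) If $1<q<3/2$, then $$\lim_{|x|\to+\infty}\frac{u(x)-\kappa|x|^2}{|x|^{4-2q}}=\chi,\qquad \chi=\frac1{2\kappa^q}\left(\frac1{3-2q}-\frac1{4-2q}+\frac1{3(5-2q)}-\frac1{3(2-2q)}\right).$$ -/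

import Mathlib

open Filter Topology Set MeasureTheory
open scoped Laplacian

/-- Three-dimensional Euclidean space `ℝ³`. -/
abbrev E3 : Type := EuclideanSpace ℝ (Fin 3)

/-- `u` is a (classical, positive, entire) radially symmetric solution of
`Δ² u + u ^ (-q) = 0` in `ℝ³`. -/
structure IsRadialSolution (q : ℝ) (u : E3 → ℝ) : Prop where
  contDiff : ContDiff ℝ 4 u
  pos : ∀ x, 0 < u x
  radial : ∀ x y : E3, ‖x‖ = ‖y‖ → u x = u y
  equation : ∀ x, Δ (Δ u) x + u x ^ (-q) = 0

/-- `u` has exactly quadratic growth `κ` at infinity: `u x / |x|² → κ` as `|x| → ∞`. -/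
def HasQuadraticGrowth (u : E3 → ℝ) (κ : ℝ) : Prop :=
  Tendsto (fun x : E3 => u x / ‖x‖ ^ 2) (Bornology.cobounded E3) (𝓝 κ)

/-- The profile `r ↦ u(r)` of a radially symmetric function on `ℝ³`, that is, its value at the
point `(r, 0, 0)`, which has norm `r` for `0 ≤ r`. -/
noncomputable def radialProfile (u : E3 → ℝ) (r : ℝ) : ℝ :=
  u (EuclideanSpace.single 0 r)

/-!
For a radial function `u` on `ℝ³` of profile `φ`, the Laplacian is again radial and satisfies
`r Δu = (r φ)''`. Applied twice, this turns the equation into an ordinary one: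
`D r = r φ(r) - κ r³` solves the fourth-order equation `D'''' = -r φ ^ (-q)` on `r > 0`
(`laplacian_of_radial`, `IsRadialSolution.exists_deriv_chain`), and quadratic growth makes the
right-hand side asymptotic to `-κ ^ (-q) r ^ (1 - 2 q)`, which is integrable since `q > 1`. So
`D'''` has a limit; the growth of `φ` forces it to be `0` (`tendsto_third_deriv`, stated for `r φ(r)`), whence
`D''' ∼ κ ^ (-q) / (2 q - 2) · r ^ (2 - 2 q)` by L'Hôpital's rule.

It remains to integrate three times, that is, to apply L'Hôpital's rule with denominators tending
to infinity (`tendsto_div_of_tendsto_deriv_div`). For `q < 3/2` all the denominators are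
powers of `r`. For `q = 3/2` the first integration produces a logarithm. For `q > 3/2` the function
`D''` is bounded, and its limit is found from the exact formula
`D'' = r D''' + ∫₀^r t² φ(t) ^ (-q) dt`, in which the first term tends to `0`. Dividing by `r` gives
the three expansions of `φ`.
-/

/-! ### L'Hôpital's rule for denominators tending to infinity -/

theorem eventually_div_lt_of_deriv_div {f f' g g' : ℝ → ℝ} {L c : ℝ}
    (hf : ∀ᶠ x in atTop, HasDerivAt f (f' x) x) (hg : ∀ᶠ x in atTop, HasDerivAt g (g' x) x)
    (hg' : ∀ᶠ x in atTop, 0 < g' x) (hgt : Tendsto g atTop atTop)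
    (h : Tendsto (fun x => f' x / g' x) atTop (𝓝 L)) (hc : L < c) :
    ∀ᶠ x in atTop, f x / g x < c := by
  obtain ⟨d, hLd, hdc⟩ := exists_between hc
  obtain ⟨R, hR⟩ := eventually_atTop.1
    (hf.and (hg.and (hg'.and (h.eventually (gt_mem_nhds hLd)))))
  have hder : ∀ x, R ≤ x → HasDerivAt (fun y => f y - d * g y) (f' x - d * g' x) x := fun x hx =>
    (hR x hx).1.sub ((hR x hx).2.1.const_mul d)
  have hanti : AntitoneOn (fun y => f y - d * g y) (Ici R) := by
    refine antitoneOn_of_hasDerivWithinAt_nonpos (f' := fun x => f' x - d * g' x) (convex_Ici R)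
      (fun x hx => (hder x hx).continuousAt.continuousWithinAt) (fun x hx => ?_) (fun x hx => ?_)
    · exact (hder x (interior_subset hx)).hasDerivWithinAt
    · obtain ⟨-, -, hpos, hlt⟩ := hR x (interior_subset hx)
      have := (div_lt_iff₀ hpos).1 hlt
      linarith
  have hK := (hgt.const_mul_atTop (sub_pos.2 hdc)).eventually_gt_atTop (f R - d * g R)
  filter_upwards [hK, hgt.eventually_gt_atTop 0, eventually_ge_atTop R] with x hx hgx hRx
  rw [div_lt_iff₀ hgx]
  have := hanti (self_mem_Ici (a := R)) hRx hRx
  simp only at this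
  nlinarith

/-- L'Hôpital's rule at `+∞` for a denominator tending to `+∞`; nothing is assumed about the
growth of the numerator. -/
theorem tendsto_div_of_tendsto_deriv_div {f f' g g' : ℝ → ℝ} {L : ℝ}
    (hf : ∀ᶠ x in atTop, HasDerivAt f (f' x) x) (hg : ∀ᶠ x in atTop, HasDerivAt g (g' x) x)
    (hg' : ∀ᶠ x in atTop, 0 < g' x) (hgt : Tendsto g atTop atTop)
    (h : Tendsto (fun x => f' x / g' x) atTop (𝓝 L)) :
    Tendsto (fun x => f x / g x) atTop (𝓝 L) := by
  refine tendsto_order.2 ⟨fun c hc => ?_, fun c hc =>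
    eventually_div_lt_of_deriv_div hf hg hg' hgt h hc⟩
  have := eventually_div_lt_of_deriv_div (f := fun x => -f x) (f' := fun x => -f' x)
    (hf.mono fun x hx => hx.neg) hg hg' hgt (by simpa only [neg_div] using h.neg) (neg_lt_neg hc)
  filter_upwards [this] with x hx
  rw [neg_div] at hx
  exact neg_lt_neg_iff.1 hx

/-- If `f' ∼ L x ^ (a - 1)` with `a > 0`, then `f ∼ (L / a) x ^ a`. -/
theorem tendsto_div_rpow_of_tendsto_deriv {f f' : ℝ → ℝ} {L a b : ℝ} (ha : 0 < a)
    (hb : b = a - 1)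
    (hf : ∀ᶠ x in atTop, HasDerivAt f (f' x) x)
    (h : Tendsto (fun x => f' x / x ^ b) atTop (𝓝 L)) :
    Tendsto (fun x => f x / x ^ a) atTop (𝓝 (L / a)) := by
  subst hb
  refine tendsto_div_of_tendsto_deriv_div (g' := fun x => a * x ^ (a - 1)) hf ?_ ?_
    (tendsto_rpow_atTop ha) ?_
  · filter_upwards [eventually_gt_atTop 0] with x hx
    exact Real.hasDerivAt_rpow_const (Or.inl hx.ne')
  · filter_upwards [eventually_gt_atTop 0] with x hx
    positivity
  · refine (h.div_const a).congr fun x => ?_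
    rw [div_div, mul_comm]

/-! ### The Laplacian of a radial function -/

theorem radial_eq_radialProfile {u : E3 → ℝ} (hu : ∀ x y : E3, ‖x‖ = ‖y‖ → u x = u y) (x : E3) :
    u x = radialProfile u ‖x‖ :=
  hu _ _ (by simp)

theorem contDiff_radialProfile {n : WithTop ℕ∞} {u : E3 → ℝ} (hu : ContDiff ℝ n u) :
    ContDiff ℝ n (radialProfile u) := by
  have : radialProfile u = u ∘ fun r : ℝ => r • (EuclideanSpace.single 0 1 : E3) := by
    funext r
    simp only [radialProfile, Function.comp_apply]
    congr 1
    ext i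
    simp [PiLp.single_apply]
  rw [this]
  exact hu.comp (contDiff_id.smul contDiff_const)

theorem contDiff_laplacian {u : E3 → ℝ} (hu : ContDiff ℝ 4 u) : ContDiff ℝ 2 (Δ u) := by
  rw [InnerProductSpace.laplacian_eq_iteratedFDeriv_stdOrthonormalBasis]
  refine ContDiff.sum fun i _ => ?_
  have h : ContDiff ℝ 2 (iteratedFDeriv ℝ 2 u) := hu.iteratedFDeriv_right (by norm_num)
  exact (ContinuousMultilinearMap.apply ℝ (fun _ : Fin 2 => E3) ℝ _).contDiff.comp h

theorem hasDerivAt_deriv_of_contDiff {φ : ℝ → ℝ} (hφ : ContDiff ℝ 2 φ) (r : ℝ) :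
    HasDerivAt φ (deriv φ r) r ∧ HasDerivAt (deriv φ) (deriv (deriv φ) r) r := by
  have h1 : ContDiff ℝ 1 (deriv φ) := by
    have := (contDiff_succ_iff_deriv (n := 1) (f := φ) (𝕜 := ℝ)).1 (by norm_num; exact hφ)
    exact this.2.2
  exact ⟨(hφ.differentiable (by norm_num) r).hasDerivAt,
    (h1.differentiable (by norm_num) r).hasDerivAt⟩

/-- The second derivative of a radial function along a coordinate direction, from two
differentiations of `t ↦ φ ‖x + t • eᵢ‖` at `0`. -/
theorem iteratedFDeriv_two_of_radial {u : E3 → ℝ} (hu2 : ContDiff ℝ 2 u)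
    (hu : ∀ x y : E3, ‖x‖ = ‖y‖ → u x = u y) {x : E3} (hx : x ≠ 0) (i : Fin 3) :
    iteratedFDeriv ℝ 2 u x ![EuclideanSpace.single i 1, EuclideanSpace.single i 1] =
      deriv (deriv (radialProfile u)) ‖x‖ * (x i / ‖x‖) ^ 2 +
        deriv (radialProfile u) ‖x‖ * (1 / ‖x‖ - x i ^ 2 / ‖x‖ ^ 3) := by
  set e : E3 := EuclideanSpace.single i 1 with he
  set φ := radialProfile u with hφ
  have hφ2 : ContDiff ℝ 2 φ := contDiff_radialProfile hu2
  -- the second derivative along the line, from the Fréchet derivatives of `u`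
  have hline : ∀ t : ℝ, HasDerivAt (fun s : ℝ => x + s • e) e t := fun t => by
    simpa using ((hasDerivAt_id t).smul_const e).const_add x
  have h1 : ∀ t : ℝ, HasDerivAt (fun s : ℝ => u (x + s • e)) (fderiv ℝ u (x + t • e) e) t :=
    fun t => ((hu2.differentiable (by norm_num) _).hasFDerivAt).comp_hasDerivAt t (hline t)
  have hfd : ContDiff ℝ 1 (fderiv ℝ u) := hu2.fderiv_right (by norm_num)
  have h2 : HasDerivAt (fun s : ℝ => fderiv ℝ u (x + s • e) e) (fderiv ℝ (fderiv ℝ u) x e e) 0 := by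
    have hfx : HasFDerivAt (fderiv ℝ u) (fderiv ℝ (fderiv ℝ u) x) (x + (0 : ℝ) • e) := by
      simpa using (hfd.differentiable (by norm_num) x).hasFDerivAt
    have hcomp : HasDerivAt (fun s : ℝ => fderiv ℝ u (x + s • e)) (fderiv ℝ (fderiv ℝ u) x e) 0 :=
      hfx.comp_hasDerivAt (0 : ℝ) (hline 0)
    exact (ContinuousLinearMap.apply ℝ ℝ e).hasFDerivAt.comp_hasDerivAt (0 : ℝ) hcomp
  -- the same derivatives, from the profile
  have hnsq : ∀ t : ℝ, ‖x + t • e‖ ^ 2 = ‖x‖ ^ 2 + 2 * t * x i + t ^ 2 := fun t => by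
    rw [norm_add_sq_real, inner_smul_right, norm_smul, he]
    simp [EuclideanSpace.inner_single_right]
    ring
  have hpos : 0 < ‖x‖ := norm_pos_iff.2 hx
  have hev : ∀ᶠ t : ℝ in 𝓝 0, x + t • e ≠ 0 := by
    have : ContinuousAt (fun t : ℝ => x + t • e) 0 := (hline 0).continuousAt
    exact this.eventually_ne (by simpa using hx)
  have hn : ∀ t : ℝ, x + t • e ≠ 0 →
      HasDerivAt (fun s : ℝ => ‖x + s • e‖) ((x i + t) / ‖x + t • e‖) t := fun t ht => by
    have hp : 0 < ‖x + t • e‖ := norm_pos_iff.2 ht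
    have hpoly : HasDerivAt (fun s : ℝ => ‖x‖ ^ 2 + 2 * s * x i + s ^ 2)
        (2 * (x i + t)) t := by
      have a1 := (((hasDerivAt_id t).const_mul 2).mul_const (x i)).const_add (‖x‖ ^ 2)
      refine (a1.add ((hasDerivAt_id t).pow 2)).congr_deriv ?_
      simp
      ring
    have hs : HasDerivAt (fun s : ℝ => √(‖x‖ ^ 2 + 2 * s * x i + s ^ 2))
        (2 * (x i + t) / (2 * √(‖x‖ ^ 2 + 2 * t * x i + t ^ 2))) t :=
      hpoly.sqrt (by rw [← hnsq]; positivity)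
    simp only [← hnsq, Real.sqrt_sq (norm_nonneg _)] at hs
    refine hs.congr_deriv ?_
    field_simp
  have h1' : (fun t : ℝ => fderiv ℝ u (x + t • e) e) =ᶠ[𝓝 0]
      fun t => deriv φ ‖x + t • e‖ * ((x i + t) / ‖x + t • e‖) := by
    filter_upwards [hev] with t ht
    refine (h1 t).unique ?_
    have := (hasDerivAt_deriv_of_contDiff hφ2 ‖x + t • e‖).1.comp t (hn t ht)
    refine this.congr_of_eventuallyEq (Eventually.of_forall fun s => ?_)
    exact radial_eq_radialProfile hu _
  have hn0 := hn 0 (by simpa using hx)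
  have h2' : HasDerivAt (fun t => deriv φ ‖x + t • e‖ * ((x i + t) / ‖x + t • e‖))
      (deriv (deriv φ) ‖x‖ * (x i / ‖x‖) ^ 2 + deriv φ ‖x‖ * (1 / ‖x‖ - x i ^ 2 / ‖x‖ ^ 3)) 0 := by
    have a1 := (hasDerivAt_deriv_of_contDiff hφ2 ‖x + (0 : ℝ) • e‖).2.comp 0 hn0
    have a2 := ((hasDerivAt_id (0 : ℝ)).const_add (x i)).div hn0 (by simpa using hx)
    refine (a1.mul a2).congr_deriv ?_
    simp
    field_simp
  have := h2.unique (h2'.congr_of_eventuallyEq h1')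
  rw [iteratedFDeriv_two_apply]
  simpa using this

/-- Away from the origin, the Laplacian of a radial function of profile `φ` on `ℝ³` is
`φ'' + 2 φ' / r`. -/
theorem laplacian_of_radial {u : E3 → ℝ} (hu2 : ContDiff ℝ 2 u)
    (hu : ∀ x y : E3, ‖x‖ = ‖y‖ → u x = u y) {x : E3} (hx : x ≠ 0) :
    Δ u x = deriv (deriv (radialProfile u)) ‖x‖ + 2 * deriv (radialProfile u) ‖x‖ / ‖x‖ := by
  rw [InnerProductSpace.laplacian_eq_iteratedFDeriv_orthonormalBasis u
    (EuclideanSpace.basisFun (Fin 3) ℝ)]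
  simp only [EuclideanSpace.basisFun_apply, iteratedFDeriv_two_of_radial hu2 hu hx]
  have hpos : 0 < ‖x‖ := norm_pos_iff.2 hx
  have hsq : ‖x‖ ^ 2 = x 0 ^ 2 + x 1 ^ 2 + x 2 ^ 2 := by
    rw [EuclideanSpace.norm_sq_eq]
    simp [Fin.sum_univ_three]
  have h2 : x 2 ^ 2 = ‖x‖ ^ 2 - x 0 ^ 2 - x 1 ^ 2 := by linarith
  rw [Fin.sum_univ_three]
  simp only [div_pow, h2]
  field_simp
  ring

theorem laplacian_radial {u : E3 → ℝ} (hu2 : ContDiff ℝ 2 u)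
    (hu : ∀ x y : E3, ‖x‖ = ‖y‖ → u x = u y) (x y : E3) (hxy : ‖x‖ = ‖y‖) :
    Δ u x = Δ u y := by
  rcases eq_or_ne x 0 with rfl | hx
  · rw [norm_zero] at hxy
    rw [norm_eq_zero.1 hxy.symm]
  · have hy : y ≠ 0 := norm_pos_iff.1 (hxy ▸ norm_pos_iff.2 hx)
    rw [laplacian_of_radial hu2 hu hx, laplacian_of_radial hu2 hu hy, hxy]

theorem radialProfile_laplacian {u : E3 → ℝ} (hu2 : ContDiff ℝ 2 u)
    (hu : ∀ x y : E3, ‖x‖ = ‖y‖ → u x = u y) {r : ℝ} (hr : 0 < r) :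
    radialProfile (Δ u) r =
      deriv (deriv (radialProfile u)) r + 2 * deriv (radialProfile u) r / r := by
  have h := laplacian_of_radial hu2 hu (x := EuclideanSpace.single 0 r) (by simpa using hr.ne')
  simpa [radialProfile, abs_of_pos hr] using h

/-! ### The profile equation -/

theorem integrableOn_Ioi_of_tendsto_div_rpow {F : ℝ → ℝ} {c s : ℝ} (hF : Continuous F)
    (h : Tendsto (fun r => F r / r ^ s) atTop (𝓝 c)) (hs : s < -1) : IntegrableOn F (Ioi 0) := by
  have hO : F =O[atTop] fun r : ℝ => r ^ s := by
    refine Asymptotics.isBigO_of_div_tendsto_nhds ?_ c h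
    filter_upwards [eventually_gt_atTop 0] with r hr h0
    exact absurd h0 (Real.rpow_pos_of_pos hr s).ne'
  have := (hF.locallyIntegrable.locallyIntegrableOn (Ici 0)).integrableOn_of_isBigO_atTop hO
    (integrableAtFilter_rpow_atTop_iff.2 hs)
  exact this.mono_set Ioi_subset_Ici_self

theorem eventually_of_pos {p : ℝ → Prop} (h : ∀ r, 0 < r → p r) :
    ∀ᶠ r in atTop, p r :=
  (eventually_gt_atTop 0).mono h

/-- `P'''` converges because its derivative `-F` is integrable, and its limit is read off from the
cubic growth of `P` by three applications of L'Hôpital's rule. -/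
theorem tendsto_third_deriv {P P1 P2 P3 F : ℝ → ℝ} {κ c s : ℝ}
    (h0 : ∀ r, 0 < r → HasDerivAt P (P1 r) r) (h1 : ∀ r, 0 < r → HasDerivAt P1 (P2 r) r)
    (h2 : ∀ r, 0 < r → HasDerivAt P2 (P3 r) r) (h3 : ∀ r, 0 < r → HasDerivAt P3 (-F r) r)
    (hF : Continuous F) (hFs : Tendsto (fun r => F r / r ^ s) atTop (𝓝 c)) (hs : s < -1)
    (hP : Tendsto (fun r => P r / r ^ 3) atTop (𝓝 κ)) : Tendsto P3 atTop (𝓝 (6 * κ)) := by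
  have hint : IntegrableOn (fun r => -F r) (Ioi 0) :=
    (integrableOn_Ioi_of_tendsto_div_rpow hF hFs hs).neg
  have hlim := tendsto_limUnder_of_hasDerivAt_of_integrableOn_Ioi (fun x hx => h3 x hx) hint
  have l2 := tendsto_div_rpow_of_tendsto_deriv (a := 1) (b := 0) (by norm_num) (by norm_num)
    (eventually_of_pos h2) (by simpa using hlim)
  have l1 := tendsto_div_rpow_of_tendsto_deriv (a := 2) (b := 1) (by norm_num) (by norm_num)
    (eventually_of_pos h1) l2
  have l0 := tendsto_div_rpow_of_tendsto_deriv (a := 3) (b := 2) (by norm_num) (by norm_num)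
    (eventually_of_pos h0) l1
  have := tendsto_nhds_unique l0 (by exact_mod_cast hP)
  have h6 : limUnder atTop P3 = 6 * κ := by linarith
  rwa [h6] at hlim

theorem tendsto_radialProfile_div_sq {u : E3 → ℝ} {κ : ℝ} (h : HasQuadraticGrowth u κ) :
    Tendsto (fun r => radialProfile u r / r ^ 2) atTop (𝓝 κ) := by
  have ht : Tendsto (fun r : ℝ => (EuclideanSpace.single 0 r : E3)) atTop
      (Bornology.cobounded E3) := by
    rw [← tendsto_norm_atTop_iff_cobounded]
    simpa using tendsto_abs_atTop_atTop
  refine (h.comp ht).congr fun r => ?_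
  simp [radialProfile]

/-- If `φ ∼ κ r²`, then `rⁿ φ ^ (-q) ∼ κ ^ (-q) r ^ (n - 2 q)`. -/
theorem tendsto_rpow_neg_div_rpow {φ : ℝ → ℝ} {κ : ℝ} (q : ℝ) (hκ : 0 < κ) (hφ : ∀ r, 0 < φ r)
    (h : Tendsto (fun r => φ r / r ^ 2) atTop (𝓝 κ)) (n : ℕ) (s : ℝ) (hs : s = n - 2 * q) :
    Tendsto (fun r => r ^ n * φ r ^ (-q) / r ^ s) atTop (𝓝 (κ ^ (-q))) := by
  refine (h.rpow_const (p := -q) (Or.inl hκ.ne')).congr' ?_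
  filter_upwards [eventually_gt_atTop 0] with r hr
  have e1 : (r ^ 2) ^ (-q) = r ^ (-(2 * q)) := by
    rw [← Real.rpow_natCast, ← Real.rpow_mul hr.le]
    congr 1
    push_cast
    ring
  have e2 : r ^ s = r ^ n * r ^ (-(2 * q)) := by
    rw [hs, sub_eq_add_neg, Real.rpow_add hr, Real.rpow_natCast]
  rw [Real.div_rpow (hφ r).le (by positivity), e1, e2, mul_div_mul_left _ _ (by positivity)]

/-- The reduction to one variable, for `D r = r u(r) - κ r³`. The equation becomes
`D'''' = -r u ^ (-q)` on `r > 0`. Smoothness of `Δ u` at the origin enters only through the formula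
for `D''`, which integrates `(D'' - r D''')' = r² u ^ (-q)` from `0`; the limit `D''' → 0`, needed
for the last clause, comes from the growth assumption. -/
theorem IsRadialSolution.exists_deriv_chain {q κ : ℝ} (hq : 1 < q) (hκ : 0 < κ) {u : E3 → ℝ}
    (hu : IsRadialSolution q u) (hgrowth : HasQuadraticGrowth u κ) :
    ∃ D1 D2 D3 : ℝ → ℝ,
      (∀ r, 0 < r → HasDerivAt (fun r => r * radialProfile u r - κ * r ^ 3) (D1 r) r) ∧
      (∀ r, 0 < r → HasDerivAt D1 (D2 r) r) ∧
      (∀ r, 0 < r → HasDerivAt D2 (D3 r) r) ∧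
      (∀ r, 0 < r → D2 r = r * D3 r + ∫ t in (0)..r, t ^ 2 * radialProfile u t ^ (-q)) ∧
      Tendsto (fun r => D3 r / r ^ (2 - 2 * q)) atTop (𝓝 (κ ^ (-q) / (2 * q - 2))) := by
  have hu2 : ContDiff ℝ 2 u := hu.contDiff.of_le (by norm_num)
  have hw2 : ContDiff ℝ 2 (Δ u) := contDiff_laplacian hu.contDiff
  have hw := laplacian_radial hu2 hu.radial
  set φ := radialProfile u with hφdef
  set W := radialProfile (Δ u) with hWdef
  have hφ2 : ContDiff ℝ 2 φ := contDiff_radialProfile hu2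
  have hW2 : ContDiff ℝ 2 W := contDiff_radialProfile hw2
  have hφpos : ∀ r, 0 < φ r := fun r => hu.pos _
  have hφd := hasDerivAt_deriv_of_contDiff hφ2
  have hWd := hasDerivAt_deriv_of_contDiff hW2
  have hφW : ∀ r, 0 < r → W r = deriv (deriv φ) r + 2 * deriv φ r / r := fun r hr =>
    radialProfile_laplacian hu2 hu.radial hr
  have hWf : ∀ r, 0 < r → deriv (deriv W) r + 2 * deriv W r / r = -φ r ^ (-q) := fun r hr => by
    rw [← radialProfile_laplacian hw2 hw hr]
    exact eq_neg_of_add_eq_zero_left (hu.equation _)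
  have hf : Continuous fun r => φ r ^ (-q) :=
    hφ2.continuous.rpow_const fun r => Or.inl (hφpos r).ne'
  have hφκ : Tendsto (fun r => φ r / r ^ 2) atTop (𝓝 κ) := tendsto_radialProfile_div_sq hgrowth
  -- the successive derivatives of `r φ`: the second is `r W`, the fourth `-r φ ^ (-q)`
  have h0 : ∀ r, 0 < r → HasDerivAt (fun r => r * φ r) (φ r + r * deriv φ r) r := fun r _ =>
    ((hasDerivAt_id r).mul (hφd r).1).congr_deriv (by simp)
  have h1 : ∀ r, 0 < r → HasDerivAt (fun r => φ r + r * deriv φ r) (r * W r) r := fun r hr =>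
    ((hφd r).1.add ((hasDerivAt_id r).mul (hφd r).2)).congr_deriv (by
      rw [hφW r hr]
      simp
      field_simp
      ring)
  have h2 : ∀ r, 0 < r → HasDerivAt (fun r => r * W r) (W r + r * deriv W r) r := fun r _ =>
    ((hasDerivAt_id r).mul (hWd r).1).congr_deriv (by simp)
  have h3 : ∀ r, 0 < r →
      HasDerivAt (fun r => W r + r * deriv W r) (-(r * φ r ^ (-q))) r := fun r hr =>
    ((hWd r).1.add ((hasDerivAt_id r).mul (hWd r).2)).congr_deriv (by
      rw [neg_mul_eq_mul_neg, ← hWf r hr]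
      simp
      field_simp
      ring)
  have hF : Tendsto (fun r => r * φ r ^ (-q) / r ^ (1 - 2 * q)) atTop (𝓝 (κ ^ (-q))) := by
    simpa using tendsto_rpow_neg_div_rpow q hκ hφpos hφκ 1 (1 - 2 * q) (by simp)
  have hlim := tendsto_third_deriv h0 h1 h2 h3 (continuous_id.mul hf) hF (by linarith)
    (hφκ.congr' (by
      filter_upwards [eventually_gt_atTop 0] with r hr
      field_simp))
  refine ⟨fun r => φ r + r * deriv φ r - κ * (3 * r ^ 2), fun r => r * W r - κ * (6 * r),
    fun r => W r + r * deriv W r - κ * 6, fun r hr => ?_, fun r hr => ?_, fun r hr => ?_,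
    fun r hr => ?_, ?_⟩
  · exact (h0 r hr).sub (((hasDerivAt_pow 3 r).const_mul κ).congr_deriv (by norm_num))
  · exact (h1 r hr).sub ((((hasDerivAt_pow 2 r).const_mul 3).const_mul κ).congr_deriv
      (by push_cast; ring))
  · exact (h2 r hr).sub ((((hasDerivAt_id r).const_mul 6).const_mul κ).congr_deriv (by norm_num))
  · have hW'c : Continuous (deriv W) :=
      continuous_iff_continuousAt.2 fun r => (hWd r).2.continuousAt
    have hG : ∀ x, 0 < x → HasDerivAt (fun r => -(r ^ 2 * deriv W r)) (x ^ 2 * φ x ^ (-q)) x :=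
      fun x hx => (((hasDerivAt_pow 2 x).mul (hWd x).2).neg).congr_deriv (by
        rw [← neg_neg (φ x ^ (-q)), ← hWf x hx]
        simp
        field_simp
        ring)
    rw [intervalIntegral.integral_eq_sub_of_hasDerivAt_of_le hr.le
      (f := fun r => -(r ^ 2 * deriv W r)) (by fun_prop) (fun x hx => hG x hx.1)
      (((continuous_pow 2).mul hf).intervalIntegrable _ _)]
    ring
  · have hg : ∀ᶠ r : ℝ in atTop, HasDerivAt (fun r : ℝ => r ^ (2 - 2 * q))
        ((2 - 2 * q) * r ^ (1 - 2 * q)) r := by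
      filter_upwards [eventually_gt_atTop 0] with r hr
      refine (Real.hasDerivAt_rpow_const (Or.inl hr.ne')).congr_deriv ?_
      ring_nf
    refine HasDerivAt.lhopital_zero_atTop (f' := fun r => -(r * φ r ^ (-q)))
      ((eventually_gt_atTop 0).mono fun r hr => (h3 r hr).sub_const _) hg ?_ ?_ ?_ ?_
    · filter_upwards [eventually_gt_atTop 0] with r hr
      exact mul_ne_zero (by linarith) (Real.rpow_pos_of_pos hr _).ne'
    · have := hlim.sub_const (κ * 6)
      rwa [mul_comm 6 κ, sub_self] at this
    · have := tendsto_rpow_neg_atTop (y := 2 * q - 2) (by linarith)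
      simpa using this
    · refine (hF.div_const (2 * q - 2)).congr fun r => ?_
      rw [div_div, neg_div, ← div_neg]
      congr 1
      ring

/-! ### Integrating the asymptotics in the three regimes -/

theorem tendsto_div_rpow_of_lt {D D1 D2 D3 : ℝ → ℝ} {q K : ℝ} (hq : q < 3 / 2)
    (h0 : ∀ r, 0 < r → HasDerivAt D (D1 r) r) (h1 : ∀ r, 0 < r → HasDerivAt D1 (D2 r) r)
    (h2 : ∀ r, 0 < r → HasDerivAt D2 (D3 r) r)
    (h3 : Tendsto (fun r => D3 r / r ^ (2 - 2 * q)) atTop (𝓝 K)) :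
    Tendsto (fun r => D r / r ^ (5 - 2 * q)) atTop
      (𝓝 (K / (3 - 2 * q) / (4 - 2 * q) / (5 - 2 * q))) := by
  have l2 := tendsto_div_rpow_of_tendsto_deriv (a := 3 - 2 * q) (by linarith) (by ring)
    (eventually_of_pos h2) h3
  have l1 := tendsto_div_rpow_of_tendsto_deriv (a := 4 - 2 * q) (by linarith) (by ring)
    (eventually_of_pos h1) l2
  exact tendsto_div_rpow_of_tendsto_deriv (a := 5 - 2 * q) (by linarith) (by ring)
    (eventually_of_pos h0) l1

theorem tendsto_log_div_affine_log {a b : ℝ} (ha : a ≠ 0) :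
    Tendsto (fun r : ℝ => Real.log r / (a * Real.log r + b)) atTop (𝓝 a⁻¹) := by
  have h := ((Real.tendsto_log_atTop.inv_tendsto_atTop.const_mul b).const_add a).inv₀
    (by simpa using ha)
  rw [mul_zero, add_zero] at h
  refine h.congr' ?_
  filter_upwards [Real.tendsto_log_atTop.eventually_gt_atTop 0] with r hr
  simp only [Pi.inv_apply]
  field_simp

theorem tendsto_div_sq_mul_log {D D1 D2 D3 : ℝ → ℝ} {K : ℝ}
    (h0 : ∀ r, 0 < r → HasDerivAt D (D1 r) r) (h1 : ∀ r, 0 < r → HasDerivAt D1 (D2 r) r)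
    (h2 : ∀ r, 0 < r → HasDerivAt D2 (D3 r) r)
    (h3 : Tendsto (fun r => D3 r / r⁻¹) atTop (𝓝 K)) :
    Tendsto (fun r => D r / (r ^ 2 * Real.log r)) atTop (𝓝 (K / 2)) := by
  have hlogpos := Real.tendsto_log_atTop.eventually_gt_atTop 0
  have l2 : Tendsto (fun r => D2 r / Real.log r) atTop (𝓝 K) :=
    tendsto_div_of_tendsto_deriv_div (eventually_of_pos h2)
      (eventually_of_pos fun r hr => Real.hasDerivAt_log hr.ne')
      (eventually_of_pos fun r hr => inv_pos.2 hr) Real.tendsto_log_atTop h3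
  have l1 : Tendsto (fun r => D1 r / (r * Real.log r)) atTop (𝓝 K) := by
    refine tendsto_div_of_tendsto_deriv_div (g' := fun r => 1 * Real.log r + 1)
      (eventually_of_pos h1)
      (eventually_of_pos fun r hr => ?_) ?_
      (tendsto_id.atTop_mul_atTop₀ Real.tendsto_log_atTop) ?_
    · exact ((hasDerivAt_id r).mul (Real.hasDerivAt_log hr.ne')).congr_deriv (by
        simp [hr.ne'])
    · filter_upwards [hlogpos] with r hr
      positivity
    · have := l2.mul (tendsto_log_div_affine_log (a := 1) (b := 1) one_ne_zero)
      rw [inv_one, mul_one] at this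
      refine this.congr' ?_
      filter_upwards [hlogpos] with r hr
      field_simp
  refine tendsto_div_of_tendsto_deriv_div (g' := fun r => r * (2 * Real.log r + 1))
    (eventually_of_pos h0)
    (eventually_of_pos fun r hr => ?_) ?_
    ((tendsto_pow_atTop two_ne_zero).atTop_mul_atTop₀ Real.tendsto_log_atTop) ?_
  · exact ((hasDerivAt_pow 2 r).mul (Real.hasDerivAt_log hr.ne')).congr_deriv (by
      field_simp
      norm_num
      ring)
  · filter_upwards [hlogpos, eventually_gt_atTop 0] with r hr hr0
    positivity
  · have := l1.mul (tendsto_log_div_affine_log (a := 2) (b := 1) two_ne_zero)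
    rw [← div_eq_mul_inv] at this
    refine this.congr' ?_
    filter_upwards [hlogpos, eventually_gt_atTop 0] with r hr hr0
    field_simp

theorem tendsto_div_sq_of_gt {D D1 D2 D3 g : ℝ → ℝ} {q K : ℝ} (hq : 3 / 2 < q)
    (h0 : ∀ r, 0 < r → HasDerivAt D (D1 r) r) (h1 : ∀ r, 0 < r → HasDerivAt D1 (D2 r) r)
    (hg : IntegrableOn g (Ioi 0)) (h2 : ∀ r, 0 < r → D2 r = r * D3 r + ∫ t in (0)..r, g t)
    (h3 : Tendsto (fun r => D3 r / r ^ (2 - 2 * q)) atTop (𝓝 K)) :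
    Tendsto (fun r => D r / r ^ 2) atTop (𝓝 ((1 / 2) * ∫ t in Ioi (0 : ℝ), g t)) := by
  -- `r D'''` is of order `r ^ (3 - 2 q)`, hence negligible
  have hz : Tendsto (fun r => r * D3 r) atTop (𝓝 0) := by
    have := h3.mul (tendsto_rpow_neg_atTop (y := 2 * q - 3) (by linarith))
    rw [mul_zero] at this
    refine this.congr' (eventually_of_pos fun r hr => ?_)
    have : r ^ (-(2 * q - 3)) = r ^ (2 - 2 * q) * r := by
      rw [← Real.rpow_add_one hr.ne']
      ring_nf
    rw [this]
    have := Real.rpow_pos_of_pos hr (2 - 2 * q)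
    field_simp
  have hD2 := hz.add (intervalIntegral_tendsto_integral_Ioi 0 hg tendsto_id)
  rw [zero_add] at hD2
  have l2 : Tendsto D2 atTop (𝓝 (∫ t in Ioi (0 : ℝ), g t)) :=
    hD2.congr' (eventually_of_pos fun r hr => (h2 r hr).symm)
  have l1 := tendsto_div_rpow_of_tendsto_deriv (a := 1) (b := 0) (by norm_num) (by norm_num)
    (eventually_of_pos h1) (by simpa using l2)
  have l0 := tendsto_div_rpow_of_tendsto_deriv (a := 2) (b := 1) (by norm_num) (by norm_num)
    (eventually_of_pos h0) l1
  rw [div_one, div_eq_inv_mul, inv_eq_one_div] at l0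
  exact_mod_cast l0

/-- Returns from `D r = r u(r) - κ r³` to `u` itself, which divides both the numerator and the
gauge `h` by `r`. -/
theorem tendsto_cobounded_of_radial {u : E3 → ℝ} (hu : ∀ x y : E3, ‖x‖ = ‖y‖ → u x = u y)
    {κ L : ℝ} {g h : ℝ → ℝ} (hgh : ∀ r, 0 < r → h r = r * g r)
    (hlim : Tendsto (fun r => (r * radialProfile u r - κ * r ^ 3) / h r) atTop (𝓝 L)) :
    Tendsto (fun x : E3 => (u x - κ * ‖x‖ ^ 2) / g ‖x‖) (Bornology.cobounded E3) (𝓝 L) := by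
  have := hlim.comp (tendsto_norm_cobounded_atTop (E := E3))
  refine this.congr' ?_
  filter_upwards [tendsto_norm_cobounded_atTop.eventually_gt_atTop 0] with x hx
  simp only [Function.comp_apply]
  rw [hgh _ hx, radial_eq_radialProfile hu x, ← mul_div_mul_left _ (g ‖x‖) hx.ne']
  congr 1
  ring

theorem theorem4 (q κ : ℝ) (hq : 1 < q) (hκ : 0 < κ) (u : E3 → ℝ)
    (hu : IsRadialSolution q u) (hgrowth : HasQuadraticGrowth u κ) :
    (3 / 2 < q →
      IntegrableOn (fun t : ℝ => t ^ 2 * radialProfile u t ^ (-q)) (Ioi 0) ∧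
      Tendsto (fun x : E3 => (u x - κ * ‖x‖ ^ 2) / ‖x‖) (Bornology.cobounded E3)
        (𝓝 ((1 / 2) * ∫ t in Ioi (0 : ℝ), t ^ 2 * radialProfile u t ^ (-q)))) ∧
    (q = 3 / 2 →
      Tendsto (fun x : E3 => (u x - κ * ‖x‖ ^ 2) / (‖x‖ * Real.log ‖x‖))
        (Bornology.cobounded E3) (𝓝 (1 / (2 * κ ^ (3 / 2 : ℝ))))) ∧
    (q < 3 / 2 →
      Tendsto (fun x : E3 => (u x - κ * ‖x‖ ^ 2) / ‖x‖ ^ (4 - 2 * q))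
        (Bornology.cobounded E3)
        (𝓝 (1 / (2 * κ ^ q) *
          (1 / (3 - 2 * q) - 1 / (4 - 2 * q) + 1 / (3 * (5 - 2 * q))
            - 1 / (3 * (2 - 2 * q)))))) := by
  obtain ⟨D1, D2, D3, h0, h1, h2, hint, h3⟩ := hu.exists_deriv_chain hq hκ hgrowth
  refine ⟨fun hq' => ?_, fun hq' => ?_, fun hq' => ?_⟩
  · have hφc : Continuous (radialProfile u) := (contDiff_radialProfile hu.contDiff).continuous
    have hI : IntegrableOn (fun t : ℝ => t ^ 2 * radialProfile u t ^ (-q)) (Ioi 0) :=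
      integrableOn_Ioi_of_tendsto_div_rpow (s := 2 - 2 * q)
        ((continuous_pow 2).mul (hφc.rpow_const fun r => Or.inl (hu.pos _).ne'))
        (tendsto_rpow_neg_div_rpow q hκ (fun r => hu.pos _)
          (tendsto_radialProfile_div_sq hgrowth) 2 _ (by norm_num)) (by linarith)
    exact ⟨hI, tendsto_cobounded_of_radial (g := id) hu.radial (fun r _ => sq r)
      (tendsto_div_sq_of_gt hq' h0 h1 hI hint h3)⟩
  · subst hq'
    have h3' : Tendsto (fun r => D3 r / r⁻¹) atTop (𝓝 (κ ^ (-(3 / 2) : ℝ))) := by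
      norm_num [Real.rpow_neg_one] at h3 ⊢
      exact h3
    have := tendsto_cobounded_of_radial (g := fun r => r * Real.log r) hu.radial
      (fun r _ => by ring) (tendsto_div_sq_mul_log h0 h1 h2 h3')
    convert this using 2
    rw [Real.rpow_neg hκ.le]
    field_simp
  · have := tendsto_cobounded_of_radial (g := fun r => r ^ (4 - 2 * q)) hu.radial
      (fun r hr => by
        rw [mul_comm r, ← Real.rpow_add_one hr.ne', show 5 - 2 * q = 4 - 2 * q + 1 by ring])
      (tendsto_div_rpow_of_lt hq' h0 h1 h2 h3)
    convert this using 2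
    have e2 : 1 - q ≠ 0 := by linarith
    have e3 : 3 - 2 * q ≠ 0 := by linarith
    have e4 : 2 - q ≠ 0 := by linarith
    have e5 : 5 - 2 * q ≠ 0 := by linarith
    have eK : κ ^ q ≠ 0 := (Real.rpow_pos_of_pos hκ q).ne'
    rw [Real.rpow_neg hκ.le, show 2 - 2 * q = 2 * (1 - q) by ring,
      show 4 - 2 * q = 2 * (2 - q) by ring, show 2 * q - 2 = -(2 * (1 - q)) by ring]
    field_simp
    ring
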